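/- Let $n\ge 1$ be an integer. Let $A=A(n)=(a_{ij})_{i,j\ge 1}$ be the infinite $\{0,1\}$-matrix constructed greedily, row by row and each row from left to right: $a_{kl}=0$ if $\sum_{j<l}a_{kj}\ge n+1$, or $\sum_{i<k}a_{il}\ge n+1$, or there are $1\le i<k$ and $1\le j<l$ with $a_{ij}=a_{il}=a_{kj}=1$; otherwise $a_{kl}=1$. Let $p=p(n)$ be the least integer $p\ge 1$ for which there is $c\ge 0$ with $a_{i+p,j+p}=a_{ij}$ for all $i>c$ and $j\ge 1$; let $pp=pp(n)$ be the least integer $c\ge 0$ such that $a_{i+p,j+p}=a_{ij}$ for all $i>c$ and $j\ge 1$ (with this $p$); and let $b(n)=\max\{|j-i| : i,j\ge 1,\ a_{ij}=1,\ i>pp\}$. These numbers exist, that is, the two minima and the maximum are attained. Let $m\ge 1$ be an integer such that $\overline p=pm$ satisfies $\lfloor \overline p/2\rfloor>b(n)$, put $r=\lfloor \overline p/2\rfloor$, and let $v\ge pp+\overline p$ be an integer. Let $B=(b_{ij})_{1\le i,j\le\overline p}$ be the folded matrix $$b_{ij}=\begin{cases} a_{v+i,\,v+j} & \text{if } i-r\le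 j\le i+r,\\ a_{v+i,\,v+j-\overline p} & \text{if } j>i+r,\\ a_{v+i,\,v+j+\overline p} & \text{if } j<i-r.\end{cases}$$ Then every column of $B$ contains exactly $n+1$ ones. Moreover, the incidence structure $\mathcal E(n)$ whose points are the columns of $B$, whose lines are the rows of $B$, and in which the $i$-th column is incident with the $j$-th row if and only if $b_{ji}=1$, is a symmetric tactical configuration: there is an integer $k$ such that every line is incident with exactly $k$ points and every point is incident with exactly $k$ lines. -/

import Mathlib

/-- The infinite `{0,1}`-matrix `A(n)` produced by the greedy (first choice) algorithm.
Rows and columns are numbered from `0`, so that `edgarMatrix n k l` is the entry in the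
`(k+1)`-st row and the `(l+1)`-st column. The entry `(k, l)` stays `0` if the part of row `k`
to the left of it, or the part of column `l` above it, already contains `n + 1` ones, or if it
would be the lower right corner of a rectangle all of whose corners are ones.
Otherwise it is `1`. -/
def edgarMatrix (n : ℕ) (k l : ℕ) : ℕ :=
  if n + 1 ≤ ∑ j : Fin l, edgarMatrix n k j.1 ∨ n + 1 ≤ ∑ i : Fin k, edgarMatrix n i.1 l then 0
  else if ∃ i : Fin k, ∃ j : Fin l,
      edgarMatrix n i.1 j.1 = 1 ∧ edgarMatrix n i.1 l = 1 ∧ edgarMatrix n k j.1 = 1 then 0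
  else 1
termination_by k + l
decreasing_by all_goals omega

/-- `IsShiftInvariantFrom n p c`: `a_{i+p,j+p} = a_{i,j}` for all rows `i` from the (0-based)
row `c` on (that is, `i > c` in 1-based numbering) and all columns `j`. -/
def IsShiftInvariantFrom (n p c : ℕ) : Prop :=
  ∀ i j : ℕ, c ≤ i → edgarMatrix n (i + p) (j + p) = edgarMatrix n i j

/-- The positive integers `p` for which `A(n)` is invariant under the diagonal shift by `p`
from some row on. -/
def periodSet (n : ℕ) : Set ℕ := {p | 1 ≤ p ∧ ∃ c : ℕ, IsShiftInvariantFrom n p c}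

/-- The period `p(n)` of `A(n)`. -/
noncomputable def period (n : ℕ) : ℕ := sInf (periodSet n)

/-- The integers `c ≥ 0` such that the shift by `p(n)` leaves `A(n)` invariant after the first
`c` rows. -/
def preperiodSet (n : ℕ) : Set ℕ := {c | IsShiftInvariantFrom n (period n) c}

/-- The preperiod `pp(n)` of `A(n)`. -/
noncomputable def preperiod (n : ℕ) : ℕ := sInf (preperiodSet n)

/-- The distances `|j - i|` from the diagonal of the ones of `A(n)` that lie below the first
`pp(n)` rows. -/
def breadthSet (n : ℕ) : Set ℕ :=
  {d | ∃ i j : ℕ, preperiod n ≤ i ∧ edgarMatrix n i j = 1 ∧ d = ((j : ℤ) - (i : ℤ)).natAbs}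

/-- The breadth `b(n)` of `A(n)`. -/
noncomputable def breadth (n : ℕ) : ℕ := sSup (breadthSet n)

/-- The `q × q` folded matrix `B` cut out of `A(n)` below and to the right of the cell `(v, v)`,
where `r = ⌊q / 2⌋`: entries with `i - r ≤ j ≤ i + r` are copied, entries with `j > i + r` are
taken `q` columns further to the left, and those with `j < i - r` are taken `q` columns further
to the right. It is used for `q ≤ v` only, so the subtraction is not truncated. -/
def foldedMatrix (n q v : ℕ) : Matrix (Fin q) (Fin q) ℕ := fun i j =>
  if i.1 + q / 2 < j.1 then edgarMatrix n (v + i.1) (v + j.1 - q)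
  else if j.1 + q / 2 < i.1 then edgarMatrix n (v + i.1) (v + j.1 + q)
  else edgarMatrix n (v + i.1) (v + j.1)

/-- The weight of column `j` of a finite `{0,1}`-matrix: the number of ones in it. -/
def columnWeight {q : ℕ} (B : Matrix (Fin q) (Fin q) ℕ) (j : Fin q) : ℕ :=
  (Finset.univ.filter fun i => B i j = 1).card

/-- An incidence structure with point set `P` and line set `L`. -/
structure IncidenceStructure (P L : Type*) where
  /-- The incidence relation. -/
  inc : P → L → Prop

/-- There is an integer `k` such that every line is incident with exactly `k` points and every
point is incident with exactly `k` lines. -/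
def IncidenceStructure.IsSymmetricTacticalConfiguration {P L : Type*}
    (S : IncidenceStructure P L) : Prop :=
  ∃ k : ℕ, (∀ l : L, {x : P | S.inc x l}.encard = k) ∧ (∀ x : P, {l : L | S.inc x l}.encard = k)

/-- The Edgar structure: points are the columns, lines are the rows of the folded matrix `B`, and
column `x` is incident with row `l` iff `b_{l,x} = 1`. -/
def edgarStructure (n q v : ℕ) : IncidenceStructure (Fin q) (Fin q) where
  inc x l := foldedMatrix n q v l x = 1

/-! The greedy rule is symmetric, so `A(n)` is symmetric. A cell of row `k` stays zero only if the
row is full, its column is full, or a rectangle blocks it. Few columns are full or blocked, so every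
row gets `n + 1` ones, all within `bandBound n` of the diagonal (`le_of_sum_edgarMatrix_row_le`,
`card_ones_row`). Hence a bounded window of rows determines the next row, and pigeonhole on windows
gives periodicity (`edgarMatrix_shift_row`, `periodSet_nonempty`). Folding moves entries by a
multiple of the period. As `breadth n` is below half the size of `B`, each row of `B` carries
exactly the ones of a row of `A(n)`; periodicity makes `B` symmetric, so columns behave like rows.
-/

theorem edgarMatrix_eq_one_iff (n k l : ℕ) :
    edgarMatrix n k l = 1 ↔
      ∑ j ∈ Finset.range l, edgarMatrix n k j ≤ n ∧ ∑ i ∈ Finset.range k, edgarMatrix n i l ≤ n ∧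
        ∀ i < k, ∀ j < l,
          ¬(edgarMatrix n i j = 1 ∧ edgarMatrix n i l = 1 ∧ edgarMatrix n k j = 1) := by
  rw [edgarMatrix, Finset.sum_range, Finset.sum_range]
  split_ifs with h₁ h₂
  · constructor
    · intro h; exact absurd h (by decide)
    · rintro ⟨h, h', -⟩; omega
  · constructor
    · intro h; exact absurd h (by decide)
    · rintro ⟨-, -, h⟩
      obtain ⟨i, j, hij⟩ := h₂
      exact absurd hij (h i i.2 j j.2)
  · refine ⟨fun _ => ⟨by omega, by omega, fun i hi j hj hij => h₂ ⟨⟨i, hi⟩, ⟨j, hj⟩, hij⟩⟩,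
      fun _ => rfl⟩

theorem edgarMatrix_le_one (n k l : ℕ) : edgarMatrix n k l ≤ 1 := by
  rw [edgarMatrix]
  split_ifs <;> simp

theorem edgarMatrix_eq_of_iff {n k l k' l' : ℕ}
    (h : edgarMatrix n k l = 1 ↔ edgarMatrix n k' l' = 1) :
    edgarMatrix n k l = edgarMatrix n k' l' := by
  have := edgarMatrix_le_one n k l
  have := edgarMatrix_le_one n k' l'
  omega

/-! ### Symmetry. -/

theorem edgarMatrix_comm (n k l : ℕ) : edgarMatrix n k l = edgarMatrix n l k := by
  induction hs : k + l using Nat.strong_induction_on generalizing k l with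
  | _ s ih =>
    subst hs
    apply edgarMatrix_eq_of_iff
    rw [edgarMatrix_eq_one_iff, edgarMatrix_eq_one_iff]
    have h₁ : ∑ j ∈ Finset.range l, edgarMatrix n k j = ∑ j ∈ Finset.range l, edgarMatrix n j k :=
      Finset.sum_congr rfl fun j hj => ih _ (by have := Finset.mem_range.1 hj; omega) k j rfl
    have h₂ : ∑ i ∈ Finset.range k, edgarMatrix n i l = ∑ i ∈ Finset.range k, edgarMatrix n l i :=
      Finset.sum_congr rfl fun i hi => ih _ (by have := Finset.mem_range.1 hi; omega) i l rfl
    rw [h₁, h₂]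
    constructor
    · rintro ⟨a, b, c⟩
      refine ⟨b, a, fun i hi j hj ⟨x, y, z⟩ => c j hj i hi ⟨?_, ?_, ?_⟩⟩
      · rwa [ih (j + i) (by omega) j i rfl]
      · rwa [ih (j + l) (by omega) j l rfl]
      · rwa [ih (k + i) (by omega) k i rfl]
    · rintro ⟨a, b, c⟩
      refine ⟨b, a, fun i hi j hj ⟨x, y, z⟩ => c j hj i hi ⟨?_, ?_, ?_⟩⟩
      · rwa [← ih (i + j) (by omega) i j rfl]
      · rwa [← ih (k + j) (by omega) k j rfl]
      · rwa [← ih (i + l) (by omega) i l rfl]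

/-! ### Row weights and the band around the diagonal. -/

theorem sum_edgarMatrix_row_le (n k l : ℕ) :
    ∑ j ∈ Finset.range l, edgarMatrix n k j ≤ n + 1 := by
  induction l with
  | zero => simp
  | succ l ih =>
    rw [Finset.sum_range_succ]
    have h := edgarMatrix_le_one n k l
    by_cases h1 : edgarMatrix n k l = 1
    · have := ((edgarMatrix_eq_one_iff n k l).1 h1).1
      omega
    · omega

theorem sum_edgarMatrix_eq_card (n k : ℕ) (s : Finset ℕ) :
    ∑ j ∈ s, edgarMatrix n k j = (s.filter fun j => edgarMatrix n k j = 1).card := by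
  rw [Finset.card_filter]
  refine Finset.sum_congr rfl fun j _ => ?_
  have := edgarMatrix_le_one n k j
  split_ifs <;> omega

theorem card_ones_row_le (n k l : ℕ) :
    ((Finset.range l).filter fun j => edgarMatrix n k j = 1).card ≤ n + 1 := by
  rw [← sum_edgarMatrix_eq_card]
  exact sum_edgarMatrix_row_le n k l

/-- A bound for the distance of the ones of `A(n)` from the diagonal. -/
def bandBound (n : ℕ) : ℕ := n + n * ((n + 1) * (n + 1))

/-- Double count the ones in the first `k` rows. -/
theorem card_full_columns_le (n k l : ℕ) :
    ((Finset.range l).filter fun j => n + 1 ≤ ∑ i ∈ Finset.range k, edgarMatrix n i j).card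
      ≤ k := by
  have h : ((Finset.range l).filter fun j =>
      n + 1 ≤ ∑ i ∈ Finset.range k, edgarMatrix n i j).card * (n + 1) ≤ k * (n + 1) :=
    calc _ ≤ ∑ j ∈ (Finset.range l).filter fun j =>
              n + 1 ≤ ∑ i ∈ Finset.range k, edgarMatrix n i j,
              ∑ i ∈ Finset.range k, edgarMatrix n i j := by
            rw [← smul_eq_mul]
            exact Finset.card_nsmul_le_sum _ _ _ fun j hj => (Finset.mem_filter.1 hj).2
      _ ≤ ∑ j ∈ Finset.range l, ∑ i ∈ Finset.range k, edgarMatrix n i j :=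
            Finset.sum_le_sum_of_subset (Finset.filter_subset _ _)
      _ = ∑ i ∈ Finset.range k, ∑ j ∈ Finset.range l, edgarMatrix n i j := Finset.sum_comm
      _ ≤ ∑ _i ∈ Finset.range k, (n + 1) :=
            Finset.sum_le_sum fun i _ => sum_edgarMatrix_row_le n i l
      _ = k * (n + 1) := by simp
  exact Nat.le_of_mul_le_mul_right h (Nat.succ_pos n)

theorem le_of_sum_edgarMatrix_row_le {n k l : ℕ}
    (h : ∑ j ∈ Finset.range l, edgarMatrix n k j ≤ n) : l ≤ k + bandBound n := by
  set R := (Finset.range l).filter fun j => edgarMatrix n k j = 1 with hR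
  set F := (Finset.range l).filter fun j => n + 1 ≤ ∑ i ∈ Finset.range k, edgarMatrix n i j
    with hF
  -- `U` contains all columns blocked by a rectangle: go from a one of row `k` along its column (a
  -- row, by symmetry) to a row `i < k`, then along that row.
  set U := R.biUnion fun j => ((Finset.range k).filter fun i => edgarMatrix n j i = 1).biUnion
    fun i => (Finset.range l).filter fun j' => edgarMatrix n i j' = 1 with hU
  have cR : R.card ≤ n := by rwa [hR, ← sum_edgarMatrix_eq_card]
  have cF : F.card ≤ k := card_full_columns_le n k l
  have cU : U.card ≤ n * ((n + 1) * (n + 1)) := by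
    refine (Finset.card_biUnion_le_card_mul _ _ ((n + 1) * (n + 1)) fun j _ => ?_).trans
      (Nat.mul_le_mul_right _ cR)
    exact (Finset.card_biUnion_le_card_mul _ _ (n + 1) fun i _ => card_ones_row_le n i l).trans
      (Nat.mul_le_mul_right _ (card_ones_row_le n j k))
  have hsub : Finset.range l ⊆ F ∪ (R ∪ U) := by
    intro j hj
    have hjl := Finset.mem_range.1 hj
    by_contra hn
    simp only [Finset.mem_union, not_or] at hn
    obtain ⟨nF, nR, nU⟩ := hn
    refine nR (Finset.mem_filter.2 ⟨hj, (edgarMatrix_eq_one_iff n k j).2 ⟨?_, ?_, ?_⟩⟩)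
    · exact (Finset.sum_le_sum_of_subset (Finset.range_subset_range.2 hjl.le)).trans h
    · by_contra hc
      exact nF (Finset.mem_filter.2 ⟨hj, by omega⟩)
    · rintro i hi j' hj' ⟨h1, h2, h3⟩
      refine nU (Finset.mem_biUnion.2 ⟨j', Finset.mem_filter.2 ⟨?_, h3⟩,
        Finset.mem_biUnion.2 ⟨i, Finset.mem_filter.2 ⟨Finset.mem_range.2 hi, ?_⟩,
          Finset.mem_filter.2 ⟨hj, h2⟩⟩⟩)
      · exact Finset.mem_range.2 (hj'.trans hjl)
      · rwa [edgarMatrix_comm]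
  have h1 := Finset.card_le_card hsub
  have h2 := Finset.card_union_le F (R ∪ U)
  have h3 := Finset.card_union_le R U
  rw [Finset.card_range] at h1
  unfold bandBound
  omega

theorem le_add_bandBound {n k l : ℕ} (h : edgarMatrix n k l = 1) : l ≤ k + bandBound n :=
  le_of_sum_edgarMatrix_row_le ((edgarMatrix_eq_one_iff n k l).1 h).1

theorem le_add_bandBound' {n k l : ℕ} (h : edgarMatrix n k l = 1) : k ≤ l + bandBound n :=
  le_add_bandBound (by rwa [edgarMatrix_comm])

theorem edgarMatrix_eq_zero {n k l : ℕ} (h : k + bandBound n < l ∨ l + bandBound n < k) :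
    edgarMatrix n k l = 0 := by
  have := edgarMatrix_le_one n k l
  by_contra hc
  have h1 : edgarMatrix n k l = 1 := by omega
  have := le_add_bandBound h1
  have := le_add_bandBound' h1
  omega

theorem card_ones_row (n k : ℕ) :
    ((Finset.range (k + bandBound n + 1)).filter fun j => edgarMatrix n k j = 1).card = n + 1 := by
  refine le_antisymm (card_ones_row_le _ _ _) ?_
  rw [← sum_edgarMatrix_eq_card]
  by_contra hc
  have := le_of_sum_edgarMatrix_row_le (n := n) (k := k) (l := k + bandBound n + 1) (by omega)
  omega

/-! ### Periodicity. -/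

theorem sum_range_add_eq_of_zero (f : ℕ → ℕ) (p l : ℕ) (h : ∀ j < p, f j = 0) :
    ∑ j ∈ Finset.range (l + p), f j = ∑ j ∈ Finset.range l, f (j + p) := by
  rw [add_comm l p, Finset.sum_range_add, Finset.sum_eq_zero fun j hj => h j (Finset.mem_range.1 hj),
    zero_add]
  simp only [add_comm]

/-- If the last `2 * bandBound n` rows above row `k` are invariant under the shift by `p`, so is
row `k`. -/
theorem edgarMatrix_shift_row {n p k : ℕ} (hk : 2 * bandBound n ≤ k)
    (hr : ∀ i < k, k ≤ i + 2 * bandBound n → ∀ j, edgarMatrix n (i + p) (j + p) = edgarMatrix n i j)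
    (l : ℕ) : edgarMatrix n (k + p) (l + p) = edgarMatrix n k l := by
  induction l using Nat.strong_induction_on with
  | _ l ih =>
    by_cases hb : k + bandBound n < l ∨ l + bandBound n < k
    · rw [edgarMatrix_eq_zero hb, edgarMatrix_eq_zero (by omega)]
    push Not at hb
    apply edgarMatrix_eq_of_iff
    rw [edgarMatrix_eq_one_iff, edgarMatrix_eq_one_iff]
    have hrow : ∑ j ∈ Finset.range (l + p), edgarMatrix n (k + p) j
        = ∑ j ∈ Finset.range l, edgarMatrix n k j := by
      rw [sum_range_add_eq_of_zero]
      · exact Finset.sum_congr rfl fun j hj => ih j (Finset.mem_range.1 hj)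
      · intro j hj
        exact edgarMatrix_eq_zero (by omega)
    -- Since `k ≤ l + bandBound n`, rows more than `2 * bandBound n` above row `k` miss the band in
    -- column `l`.
    have hent : ∀ i < k, edgarMatrix n (i + p) (l + p) = edgarMatrix n i l := by
      intro i hi
      by_cases hw : k ≤ i + 2 * bandBound n
      · exact hr i hi hw l
      · rw [edgarMatrix_eq_zero (by omega), edgarMatrix_eq_zero (by omega)]
    have hcol : ∑ i ∈ Finset.range (k + p), edgarMatrix n i (l + p)
        = ∑ i ∈ Finset.range k, edgarMatrix n i l := by
      rw [sum_range_add_eq_of_zero]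
      · exact Finset.sum_congr rfl fun i hi => hent i (Finset.mem_range.1 hi)
      · intro i hi
        exact edgarMatrix_eq_zero (by omega)
    rw [hrow, hcol]
    refine and_congr_right fun _ => and_congr_right fun _ => ⟨fun h i hi j hj hij => ?_,
      fun h i hi j hj hij => ?_⟩
    · obtain ⟨h1, h2, h3⟩ := hij
      have := le_add_bandBound h2
      refine h (i + p) (by omega) (j + p) (by omega) ⟨?_, ?_, ?_⟩
      · rwa [hr i hi (by omega)]
      · rwa [hent i hi]
      · rwa [ih j hj]
    · obtain ⟨h1, h2, h3⟩ := hij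
      have := le_add_bandBound h2
      have := le_add_bandBound' h3
      obtain ⟨i, rfl⟩ := Nat.exists_eq_add_of_le' (show p ≤ i by omega)
      obtain ⟨j, rfl⟩ := Nat.exists_eq_add_of_le' (show p ≤ j by omega)
      refine h i (by omega) j (by omega) ⟨?_, ?_, ?_⟩
      · rwa [← hr i (by omega) (by omega)]
      · rwa [← hent i (by omega)]
      · rwa [← ih j (by omega)]

theorem isShiftInvariantFrom_of_window {n p c : ℕ}
    (h : ∀ i, c ≤ i → i < c + 2 * bandBound n → ∀ j,
      edgarMatrix n (i + p) (j + p) = edgarMatrix n i j) : IsShiftInvariantFrom n p c := by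
  intro i j hi
  induction i using Nat.strong_induction_on generalizing j with
  | _ i ih =>
    by_cases hw : i < c + 2 * bandBound n
    · exact h i hi hw j
    · exact edgarMatrix_shift_row (by omega) (fun i' hi' hk j' => ih i' hi' j' (by omega)) j

theorem periodSet_nonempty (n : ℕ) : (periodSet n).Nonempty := by
  -- The window has `2 * bandBound n` rows and is wide enough to contain their whole band. There are
  -- finitely many such patterns.
  let f : ℕ → Fin (2 * bandBound n) → Fin (4 * bandBound n + 1) → Prop :=
    fun c x y => edgarMatrix n (c + bandBound n + x) (c + y) = 1
  have key : ∀ c d, c < d → f c = f d → (periodSet n).Nonempty := by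
    intro c d hcd hf
    obtain ⟨p, rfl⟩ := Nat.exists_eq_add_of_lt hcd
    refine ⟨p + 1, by omega, c + bandBound n, isShiftInvariantFrom_of_window ?_⟩
    intro i hi hi' j
    by_cases hb : i + bandBound n < j ∨ j + bandBound n < i
    · rw [edgarMatrix_eq_zero hb, edgarMatrix_eq_zero (by omega)]
    push Not at hb
    apply edgarMatrix_eq_of_iff
    have h := congrFun (congrFun hf ⟨i - (c + bandBound n), by omega⟩) ⟨j - c, by omega⟩
    simp only [f, eq_iff_iff] at h
    rw [show c + bandBound n + (i - (c + bandBound n)) = i by omega,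
      show c + (j - c) = j by omega,
      show c + p + 1 + bandBound n + (i - (c + bandBound n)) = i + (p + 1) by omega,
      show c + p + 1 + (j - c) = j + (p + 1) by omega] at h
    exact h.symm
  obtain ⟨c, d, hne, hf⟩ := Finite.exists_ne_map_eq_of_infinite f
  rcases lt_or_gt_of_ne hne with h | h
  · exact key c d h hf
  · exact key d c h hf.symm

theorem period_isLeast (n : ℕ) : IsLeast (periodSet n) (period n) :=
  ⟨Nat.sInf_mem (periodSet_nonempty n), fun _ h => Nat.sInf_le h⟩

theorem preperiod_isLeast (n : ℕ) : IsLeast (preperiodSet n) (preperiod n) :=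
  ⟨Nat.sInf_mem (period_isLeast n).1.2, fun _ h => Nat.sInf_le h⟩

theorem exists_edgarMatrix_eq_one (n k : ℕ) : ∃ l, edgarMatrix n k l = 1 := by
  have h : 0 < ((Finset.range (k + bandBound n + 1)).filter
      fun j => edgarMatrix n k j = 1).card := by
    rw [card_ones_row]; omega
  obtain ⟨l, hl⟩ := Finset.card_pos.1 h
  exact ⟨l, (Finset.mem_filter.1 hl).2⟩

theorem breadth_isGreatest (n : ℕ) : IsGreatest (breadthSet n) (breadth n) := by
  have hne : (breadthSet n).Nonempty := by
    obtain ⟨l, hl⟩ := exists_edgarMatrix_eq_one n (preperiod n)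
    exact ⟨_, preperiod n, l, le_rfl, hl, rfl⟩
  -- Without a bound, `sSup` on `ℕ` would be the junk value `0`.
  have hbdd : BddAbove (breadthSet n) := by
    refine ⟨bandBound n, ?_⟩
    rintro _ ⟨i, j, -, h, rfl⟩
    have := le_add_bandBound h
    have := le_add_bandBound' h
    omega
  exact ⟨Nat.sSup_mem hne hbdd, fun _ h => le_csSup hbdd h⟩

/-! ### The folded matrix. -/

theorem natAbs_le_breadth {n i j : ℕ} (hi : preperiod n ≤ i) (h : edgarMatrix n i j = 1) :
    j ≤ i + breadth n ∧ i ≤ j + breadth n := by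
  have := (breadth_isGreatest n).2 ⟨i, j, hi, h, rfl⟩
  omega

theorem edgarMatrix_add_period_mul {n i : ℕ} (m j : ℕ) (hi : preperiod n ≤ i) :
    edgarMatrix n (i + period n * m) (j + period n * m) = edgarMatrix n i j := by
  induction m with
  | zero => simp
  | succ m ih =>
    rw [Nat.mul_succ, ← add_assoc, ← add_assoc, (preperiod_isLeast n).1 _ _ (by omega), ih]

theorem foldedMatrix_comm {n m v : ℕ} (hv : preperiod n + period n * m ≤ v)
    (i j : Fin (period n * m)) :
    foldedMatrix n (period n * m) v i j = foldedMatrix n (period n * m) v j i := by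
  -- Reflect, then shift by `period n * m`; `hv` keeps the starting row `v + j - period n * m` past
  -- the preperiod.
  have key : ∀ i j : ℕ, edgarMatrix n (v + i) (v + j - period n * m)
      = edgarMatrix n (v + j) (v + i + period n * m) := by
    intro i j
    rw [edgarMatrix_comm n (v + i), ← edgarMatrix_add_period_mul m _ (by omega),
      Nat.sub_add_cancel (by omega)]
  unfold foldedMatrix
  split_ifs
  all_goals first
    | omega
    | exact key _ _
    | exact (key _ _).symm
    | exact edgarMatrix_comm _ _ _

/-- The column of `A(n)` from which the entry `(i, j)` of the folded matrix is taken. -/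
def foldedColumn (q v i j : ℕ) : ℕ :=
  if i + q / 2 < j then v + j - q else if j + q / 2 < i then v + j + q else v + j

theorem foldedMatrix_eq (n q v : ℕ) (i j : Fin q) :
    foldedMatrix n q v i j = edgarMatrix n (v + i) (foldedColumn q v i j) := by
  unfold foldedMatrix foldedColumn
  split_ifs <;> rfl

/-- `foldedColumn` preserves `v + j` modulo `q`, so it is injective in `j`; by `hq` its values reach
every one of row `v + i`. -/
theorem card_ones_row_foldedMatrix {n q v : ℕ} (hq : breadth n < q / 2)
    (hv : preperiod n + q ≤ v) (i : Fin q) :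
    (Finset.univ.filter fun j => foldedMatrix n q v i j = 1).card = n + 1 := by
  rw [← card_ones_row n (v + i)]
  have hi := i.2
  refine Finset.card_bij (fun j _ => foldedColumn q v i j) ?_ ?_ ?_
  · intro j hj
    have h := (Finset.mem_filter.1 hj).2
    rw [foldedMatrix_eq] at h
    exact Finset.mem_filter.2
      ⟨Finset.mem_range.2 (Nat.lt_succ_of_le (le_add_bandBound h)), h⟩
  · intro j _ j' _ h
    have := j.2
    have := j'.2
    simp only [foldedColumn] at h
    ext
    split_ifs at h <;> omega
  · intro t ht
    have h := (Finset.mem_filter.1 ht).2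
    obtain ⟨h1, h2⟩ := natAbs_le_breadth (by omega) h
    have : ∃ j : Fin q, foldedColumn q v i j = t := by
      unfold foldedColumn
      rcases lt_or_ge t v with htv | htv
      · refine ⟨⟨t + q - v, by omega⟩, ?_⟩
        dsimp only
        split_ifs <;> omega
      · rcases lt_or_ge t (v + q) with htq | htq
        · refine ⟨⟨t - v, by omega⟩, ?_⟩
          dsimp only
          split_ifs <;> omega
        · refine ⟨⟨t - v - q, by omega⟩, ?_⟩
          dsimp only
          split_ifs <;> omega
    obtain ⟨j, rfl⟩ := this
    refine ⟨j, Finset.mem_filter.2 ⟨Finset.mem_univ _, ?_⟩, rfl⟩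
    rwa [foldedMatrix_eq]

theorem theorem4p3 (n : ℕ) (hn : 1 ≤ n) :
    IsLeast (periodSet n) (period n) ∧
    IsLeast (preperiodSet n) (preperiod n) ∧
    IsGreatest (breadthSet n) (breadth n) ∧
    ∀ m v : ℕ, 1 ≤ m → breadth n < period n * m / 2 → preperiod n + period n * m ≤ v →
      (∀ j : Fin (period n * m), columnWeight (foldedMatrix n (period n * m) v) j = n + 1) ∧
      (edgarStructure n (period n * m) v).IsSymmetricTacticalConfiguration := by
  refine ⟨period_isLeast n, preperiod_isLeast n, breadth_isGreatest n, fun m v _ hb hv => ?_⟩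
  have hrow := card_ones_row_foldedMatrix hb hv
  have hcol : ∀ j, columnWeight (foldedMatrix n (period n * m) v) j = n + 1 := by
    intro j
    rw [← hrow j]
    simp only [columnWeight, foldedMatrix_comm hv _ j]
  refine ⟨hcol, n + 1, fun l => ?_, fun x => ?_⟩
  · rw [← hrow l, ← Set.encard_coe_eq_coe_finsetCard]
    simp [edgarStructure]
  · rw [← hcol x, columnWeight, ← Set.encard_coe_eq_coe_finsetCard]
    simp [edgarStructure]
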